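/- Let $G$ be a finite connected simple graph. An all-to-all routing $R$ of $G$ assigns to every ordered pair $(x,y)$ of distinct vertices exactly one path of $G$ oriented from $x$ to $y$. The load of an edge under $R$ is the number of paths of $R$ that use it in either direction; the load of an arc (an ordered pair of adjacent vertices) is the number of paths of $R$ that use it along its direction. Let $\pi(G)$ (the edge-forwarding index) be the minimum over all $R$ of the maximum load of an edge, and let $\overrightarrow{\pi}(G)$ (the arc-forwarding index) be the minimum over all $R$ of the maximum load of an arc. Let $n\ge 5$ and $s$ be integers with $1<s<n/2$, and let $C_n(1,s)$ be the graph with vertex set $\mathbb{Z}/n\mathbb{Z}$ in which $i,j$ are adjacent if and only if $i-j\in\{1,s,-1,-s\}$. Put $q=\lfloor n/s\rfloor$ and $r=n-qs$, and let $\epsilon(x)=1$ if the integer $x$ is odd and $\epsilon(x)=0$ if $x$ is even. Then the following hold. (a) If $2\le s\le\sqrt n-1$, then $$\frac{n^2-\epsilon(n)}{8(s+1)}\le\frac{\pi(C_n(1,s))}{2}\le\overrightarrow{\pi}(C_n(1,s))\le\frac{(n-r)(n+r+2)+s^2}{8s}.$$ (b) If $s=\sqrt n$, then $$\frac{\sqrt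 n\,(n-1)}{8}\le\frac{\pi(C_n(1,s))}{2}\le\overrightarrow{\pi}(C_n(1,s))\le\frac{\sqrt n\,(n-\epsilon(s))}{8}.$$ (c) If $\sqrt n+1\le s<n/2$, then $$\max\left\{\frac{n^2-\epsilon(n)}{8(s+1)},\ \frac{(n-1)(\sqrt{2n}-7)^3}{24n}\right\}\le\frac{\pi(C_n(1,s))}{2}\le\overrightarrow{\pi}(C_n(1,s))\le\frac{s^2(n+r+2)-\epsilon(s)(n-r)}{8s}.$$ -/

import Mathlib

namespace CirculantForwarding

/-- A connection request: an ordered pair of distinct vertices. -/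
abbrev Request (V : Type*) := {p : V × V // p.1 ≠ p.2}

/-- An all-to-all routing: for each ordered pair `(x, y)` of distinct vertices, exactly one
(simple) path of `G` oriented from `x` to `y`. -/
abbrev Routing {V : Type*} (G : SimpleGraph V) :=
  (p : Request V) → G.Path p.1.1 p.1.2

section Loads

variable {V : Type*} {G : SimpleGraph V}

/-- The load of an edge: the number of paths of the routing that pass through the edge, in either
direction. -/
noncomputable def edgeLoad (R : Routing G) (e : G.edgeSet) : ℕ :=
  Set.ncard {p : Request V | (e : Sym2 V) ∈ (R p : G.Walk p.1.1 p.1.2).edges}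

/-- The load of an arc: the number of paths of the routing that pass through the arc along its
direction. An arc is an ordered pair of adjacent vertices, that is, a `SimpleGraph.Dart`. -/
noncomputable def arcLoad (R : Routing G) (a : G.Dart) : ℕ :=
  Set.ncard {p : Request V | a ∈ (R p : G.Walk p.1.1 p.1.2).darts}

/-- The maximum load of an edge under a routing (for a finite graph the supremum is a maximum). -/
noncomputable def maxEdgeLoad (R : Routing G) : ℕ := ⨆ e : G.edgeSet, edgeLoad R e

/-- The maximum load of an arc under a routing (for a finite graph the supremum is a maximum). -/
noncomputable def maxArcLoad (R : Routing G) : ℕ := ⨆ a : G.Dart, arcLoad R a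

end Loads

/-- The edge-forwarding index `π(G)`: the minimum over all routings of the maximum edge load
(for a connected graph, routings exist and the infimum in `ℕ` is attained). -/
noncomputable def edgeForwardingIndex {V : Type*} (G : SimpleGraph V) : ℕ :=
  ⨅ R : Routing G, maxEdgeLoad R

/-- The arc-forwarding index: the minimum over all routings of the maximum arc load. -/
noncomputable def arcForwardingIndex {V : Type*} (G : SimpleGraph V) : ℕ :=
  ⨅ R : Routing G, maxArcLoad R

/-- The circulant graph `C_n(1, s)` on the integers modulo `n`, with connection set
`{1, s, -1, -s}`. -/
def circulantOne (n s : ℕ) : SimpleGraph (ZMod n) :=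
  SimpleGraph.circulantGraph ({1, (s : ZMod n), -1, -(s : ZMod n)} : Set (ZMod n))

/-- The parity indicator: `1` for odd integers and `0` for even integers. -/
def parity (x : ℕ) : ℕ := if Odd x then 1 else 0

end CirculantForwarding

/-! The upper bounds come from one translation-invariant routing. A difference `k ≤ n / 2` is
written as `k = a + b * s` with `b` the rounded quotient of `k` by `s`, so `|a|` is the distance
from `k` to the nearest multiple of `s`; a difference above `n / 2` uses the negated word of `n -
k`. This antisymmetry balances `g` against `-g`: each `±1` arc carries at most the sum of `distMul s
k` over `k ≤ n / 2`, and each `±s` arc at most the sum of `roundDiv s k`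
(`exists_routing_circulantOne`). Evaluating these sums over periods of length `s` gives all three
upper bounds. The `±s` bound dominates when `s ≤ n / s`, the `±1` bound dominates when `s ≥ n / s +
2`, and at `n = s ^ 2` the two sums coincide.

There are two kinds of lower bound. Cutting the cycle into two near-halves leaves only `2 * (s + 1)`
edges to carry all crossing traffic (`sq_sub_parity_le_edgeForwardingIndex`). Alternatively, total
path length is at most `2 * n * π`, so the distances from `0` sum to at most `2 * π`
(`sum_le_two_mul_edgeForwardingIndex`). For general `s`, that distance sum is bounded below because
few residues can be close to `0`: the representations `a + b * s` inject them into the lattice `ℤ²`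
with its `ℓ¹` norm. For `n = s ^ 2`, the explicit function `squareDist` gives the sharper bound `(s
^ 3 - s) / 2`.

The middle inequality holds because an edge consists of two opposite arcs. -/

namespace CirculantForwarding

/-! ### Loads, cuts and total path length in arbitrary graphs -/

section General

variable {V : Type*} {G : SimpleGraph V}

theorem edgeLoad_le_maxEdgeLoad [Finite V] (R : Routing G) (e : G.edgeSet) :
    edgeLoad R e ≤ maxEdgeLoad R :=
  le_ciSup (f := fun e : G.edgeSet => edgeLoad R e) (Set.finite_range _).bddAbove e

theorem arcLoad_le_maxArcLoad [Finite V] (R : Routing G) (a : G.Dart) :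
    arcLoad R a ≤ maxArcLoad R := by
  have : Finite G.Dart := Finite.of_injective _ SimpleGraph.Dart.toProd_injective
  exact le_ciSup (f := fun a : G.Dart => arcLoad R a) (Set.finite_range _).bddAbove a

/-- The number of paths through an arbitrary unordered pair is at most the maximum edge load. -/
theorem ncard_mem_edges_le_maxEdgeLoad [Finite V] (R : Routing G) (e : Sym2 V) :
    Set.ncard {p : Request V | e ∈ (R p : G.Walk p.1.1 p.1.2).edges} ≤ maxEdgeLoad R := by
  by_cases he : e ∈ G.edgeSet
  · exact edgeLoad_le_maxEdgeLoad R ⟨e, he⟩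
  · have : {p : Request V | e ∈ (R p : G.Walk p.1.1 p.1.2).edges} = ∅ := by
      ext p
      simp only [Set.mem_ofPred_eq, Set.mem_empty_iff_false, iff_false]
      exact fun h => he (SimpleGraph.Walk.edges_subset_edgeSet _ h)
    simp [this]

theorem maxEdgeLoad_le_two_mul_maxArcLoad [Finite V] (R : Routing G) :
    maxEdgeLoad R ≤ 2 * maxArcLoad R := by
  refine ciSup_le' ?_
  rintro ⟨e, he⟩
  induction e using Sym2.ind with
  | _ x y =>
    have hxy : G.Adj x y := he
    let a : G.Dart := ⟨(x, y), hxy⟩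
    have hsub : {p : Request V | s(x, y) ∈ (R p : G.Walk p.1.1 p.1.2).edges} ⊆
        {p : Request V | a ∈ (R p : G.Walk p.1.1 p.1.2).darts} ∪
        {p : Request V | a.symm ∈ (R p : G.Walk p.1.1 p.1.2).darts} := by
      intro p hp
      simp only [Set.mem_ofPred_eq, SimpleGraph.Walk.edges, List.mem_map] at hp
      obtain ⟨b, hb, hbe⟩ := hp
      have hba : b.edge = a.edge := hbe
      rcases (SimpleGraph.dart_edge_eq_iff b a).1 hba with h | h
      · exact Or.inl (by rw [← h]; exact hb)
      · exact Or.inr (by rw [← h]; exact hb)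
    calc edgeLoad R ⟨s(x, y), he⟩
        ≤ arcLoad R a + arcLoad R a.symm :=
          (Set.ncard_le_ncard hsub (Set.toFinite _)).trans (Set.ncard_union_le _ _)
      _ ≤ 2 * maxArcLoad R := by
          have h1 := arcLoad_le_maxArcLoad R a
          have h2 := arcLoad_le_maxArcLoad R a.symm
          omega

/-- A routing that is optimal for arcs is a competitor for the edge index. -/
theorem edgeForwardingIndex_le_two_mul_arcForwardingIndex [Finite V] [Nonempty (Routing G)] :
    edgeForwardingIndex G ≤ 2 * arcForwardingIndex G := by
  obtain ⟨R, hR⟩ : ∃ R : Routing G, maxArcLoad R = arcForwardingIndex G :=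
    Nat.sInf_mem (Set.range_nonempty _)
  calc edgeForwardingIndex G ≤ maxEdgeLoad R := ciInf_le' _ R
    _ ≤ 2 * maxArcLoad R := maxEdgeLoad_le_two_mul_maxArcLoad R
    _ = _ := by rw [hR]

theorem exists_maxEdgeLoad_eq [Nonempty (Routing G)] :
    ∃ R : Routing G, maxEdgeLoad R = edgeForwardingIndex G :=
  Nat.sInf_mem (Set.range_nonempty _)

/-- A family of unordered pairs that meets every path of the routing between `S` and its
complement carries the whole traffic between them. -/
theorem two_mul_card_mul_card_compl_le [Fintype V] [DecidableEq V] (R : Routing G) (S : Finset V)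
    {ι : Type*} (T : Finset ι) (f : ι → Sym2 V)
    (hT : ∀ x y, G.Adj x y → x ∈ S → y ∉ S → ∃ t ∈ T, f t = s(x, y)) :
    2 * (S.card * Sᶜ.card) ≤ T.card * maxEdgeLoad R := by
  classical
  have key : ∀ p : Request V, (p.1.1 ∈ S ∧ p.1.2 ∉ S) ∨ (p.1.2 ∈ S ∧ p.1.1 ∉ S) →
      ∃ t ∈ T, f t ∈ (R p : G.Walk p.1.1 p.1.2).edges := by
    intro p hp
    rcases hp with hp | hp
    · obtain ⟨d, hd, h1, h2⟩ := SimpleGraph.Walk.exists_boundary_dart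
        (R p : G.Walk p.1.1 p.1.2) (S : Set V) hp.1 hp.2
      obtain ⟨t, ht, hte⟩ := hT _ _ d.adj h1 h2
      refine ⟨t, ht, ?_⟩
      rw [hte]
      exact List.mem_map.2 ⟨d, hd, rfl⟩
    · obtain ⟨d, hd, h1, h2⟩ := SimpleGraph.Walk.exists_boundary_dart
        (R p : G.Walk p.1.1 p.1.2) (Sᶜ : Set V) hp.2 (by simpa using hp.1)
      have h2' : d.snd ∈ S := by simpa using h2
      obtain ⟨t, ht, hte⟩ := hT _ _ d.adj.symm h2' h1
      refine ⟨t, ht, ?_⟩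
      rw [hte, Sym2.eq_swap]
      exact List.mem_map.2 ⟨d, hd, rfl⟩
  -- The cut is crossed by requests in both directions, whence the factor 2.
  let C : Finset (V × V) := S ×ˢ Sᶜ ∪ Sᶜ ×ˢ S
  have hC : C.card = 2 * (S.card * Sᶜ.card) := by
    rw [Finset.card_union_of_disjoint, Finset.card_product, Finset.card_product]
    · ring
    · rw [Finset.disjoint_left]
      rintro ⟨x, y⟩ h1 h2
      simp only [Finset.mem_product, Finset.mem_compl] at h1 h2
      exact h2.1 h1.1
  let F : ι → Finset (V × V) := fun t =>
    (Finset.univ.filter fun p : Request V => f t ∈ (R p : G.Walk p.1.1 p.1.2).edges).image (·.1)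
  have hsub : C ⊆ T.biUnion F := by
    rintro ⟨x, y⟩ hxy
    have hxy' : (x ∈ S ∧ y ∉ S) ∨ (y ∈ S ∧ x ∉ S) := by
      simp only [C, Finset.mem_union, Finset.mem_product, Finset.mem_compl] at hxy
      tauto
    have hne : x ≠ y := by
      rintro rfl
      tauto
    obtain ⟨t, ht, h⟩ := key ⟨(x, y), hne⟩ hxy'
    refine Finset.mem_biUnion.2 ⟨t, ht, Finset.mem_image.2 ⟨⟨(x, y), hne⟩, ?_, rfl⟩⟩
    simpa using h
  have hF : ∀ t ∈ T, (F t).card ≤ maxEdgeLoad R := by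
    intro t _
    refine Finset.card_image_le.trans ?_
    have := ncard_mem_edges_le_maxEdgeLoad R (f t)
    rwa [Set.ncard_eq_toFinset_card', Set.toFinset_ofPred] at this
  rw [← hC]
  exact (Finset.card_le_card hsub).trans (Finset.card_biUnion_le_card_mul _ _ _ hF)

/-- The total length of the paths is at most the number of edges times the maximum load. -/
theorem sum_length_le_card_mul_maxEdgeLoad [Fintype V] [DecidableEq V] (R : Routing G)
    {ι : Type*} [Fintype ι] (f : ι → Sym2 V) (hf : G.edgeSet ⊆ Set.range f) :
    ∑ p : Request V, (R p : G.Walk p.1.1 p.1.2).length ≤ Fintype.card ι * maxEdgeLoad R := by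
  classical
  have h1 : ∀ p : Request V, (R p : G.Walk p.1.1 p.1.2).length ≤
      (Finset.univ.filter fun t => f t ∈ (R p : G.Walk p.1.1 p.1.2).edges).card := by
    intro p
    rw [← SimpleGraph.Walk.length_edges,
      ← List.toFinset_card_of_nodup (R p).2.isTrail.edges_nodup]
    refine (Finset.card_le_card ?_).trans (Finset.card_image_le (f := f))
    intro e he
    rw [List.mem_toFinset] at he
    obtain ⟨t, rfl⟩ := hf (SimpleGraph.Walk.edges_subset_edgeSet _ he)
    exact Finset.mem_image.2 ⟨t, by simpa using he, rfl⟩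
  calc ∑ p : Request V, (R p : G.Walk p.1.1 p.1.2).length
      ≤ ∑ p : Request V,
        (Finset.univ.filter fun t => f t ∈ (R p : G.Walk p.1.1 p.1.2).edges).card :=
        Finset.sum_le_sum fun p _ => h1 p
    _ = ∑ t : ι, (Finset.univ.filter fun p : Request V =>
          f t ∈ (R p : G.Walk p.1.1 p.1.2).edges).card := by
        simp only [Finset.card_filter]
        exact Finset.sum_comm
    _ ≤ ∑ _t : ι, maxEdgeLoad R := by
        refine Finset.sum_le_sum fun t _ => ?_
        have := ncard_mem_edges_le_maxEdgeLoad R (f t)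
        rwa [Set.ncard_eq_toFinset_card', Set.toFinset_ofPred] at this
    _ = _ := by simp

end General

/-! ### Translation-invariant routings of Cayley graphs -/

section Translation

variable {A : Type*} [AddCommGroup A]

/-- The word `l`, read as a walk from `x` in a Cayley graph, makes the step `u → u + g`. -/
def UsesStep (u g : A) : List A → A → Prop
  | [], _ => False
  | h :: l, x => (x = u ∧ h = g) ∨ UsesStep u g l (x + h)

/-- For each occurrence of `g` in the word, exactly one starting point brings the walk to `u` at
that moment. -/
theorem ncard_usesStep_le [Finite A] [DecidableEq A] (u g : A) (l : List A) :
    Set.ncard {x | UsesStep u g l x} ≤ l.count g := by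
  induction l with
  | nil => simp [UsesStep]
  | cons h l ih =>
    have hsub : {x | UsesStep u g (h :: l) x} ⊆
        {x | x = u ∧ h = g} ∪ (fun x => x - h) '' {x | UsesStep u g l x} := by
      rintro x (hx | hx)
      · exact Or.inl hx
      · exact Or.inr ⟨x + h, hx, by simp⟩
    refine (Set.ncard_le_ncard hsub (Set.toFinite _)).trans ((Set.ncard_union_le _ _).trans ?_)
    have h1 : Set.ncard ((fun x => x - h) '' {x | UsesStep u g l x}) ≤ l.count g :=
      (Set.ncard_image_le (Set.toFinite _)).trans ih
    rw [List.count_cons]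
    by_cases hg : h = g
    · simp only [hg, and_true, Set.ofPred_eq_eq_singleton, Set.ncard_singleton, beq_self_eq_true,
        if_true]
      rw [hg] at h1
      omega
    · simp only [hg, and_false, Set.ofPred_false, Set.ncard_empty, beq_iff_eq, if_false]
      omega

theorem exists_walk_of_word (s : Set A) (l : List A)
    (hl : ∀ g ∈ l, (SimpleGraph.circulantGraph s).Adj 0 g) (x y : A) (hy : y = x + l.sum) :
    ∃ w : (SimpleGraph.circulantGraph s).Walk x y,
      ∀ a ∈ w.darts, UsesStep a.fst (a.snd - a.fst) l x := by
  induction l generalizing x with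
  | nil =>
    obtain rfl : y = x := by simpa using hy
    exact ⟨SimpleGraph.Walk.nil, by simp⟩
  | cons h l ih =>
    obtain ⟨w, hw⟩ := ih (fun g hg => hl g (List.mem_cons_of_mem _ hg)) (x + h)
      (by rw [hy, List.sum_cons, add_assoc])
    have hadj : (SimpleGraph.circulantGraph s).Adj x (x + h) := by
      have := hl h List.mem_cons_self
      simpa [SimpleGraph.circulantGraph_adj, eq_comm] using this
    refine ⟨SimpleGraph.Walk.cons hadj w, ?_⟩
    intro a ha
    rw [SimpleGraph.Walk.darts_cons, List.mem_cons] at ha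
    rcases ha with rfl | ha
    · exact Or.inl ⟨rfl, by simp⟩
    · exact Or.inr (hw a ha)

/-- A translation invariant routing, given by one word for each difference, loads an arc `u → u + g`
at most as often as the letter `g` occurs in the words. -/
theorem exists_routing_of_words [Fintype A] [DecidableEq A] (s : Set A) (W : A → List A)
    (hsum : ∀ d, (W d).sum = d)
    (hW : ∀ d, ∀ g ∈ W d, (SimpleGraph.circulantGraph s).Adj 0 g) :
    ∃ R : Routing (SimpleGraph.circulantGraph s), ∀ a : (SimpleGraph.circulantGraph s).Dart,
      arcLoad R a ≤ ∑ d, (W d).count (a.snd - a.fst) := by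
  classical
  have h : ∀ x y : A, ∃ w : (SimpleGraph.circulantGraph s).Walk x y,
      ∀ a ∈ w.darts, UsesStep a.fst (a.snd - a.fst) (W (y - x)) x := fun x y =>
    exists_walk_of_word s (W (y - x)) (hW _) x y (by rw [hsum]; abel)
  choose w hw using h
  -- A word may revisit vertices; removing the loops only discards darts, so the load estimate
  -- survives.
  refine ⟨fun p => (w p.1.1 p.1.2).toPath, fun a => ?_⟩
  -- A request is recorded as its difference and its source: the difference selects the word, and
  -- the source is what `UsesStep` counts.
  have hinj : Function.Injective fun p : Request A => (p.1.2 - p.1.1, p.1.1) := by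
    rintro ⟨⟨x, y⟩, h1⟩ ⟨⟨x', y'⟩, h2⟩ h
    simp only [Prod.mk.injEq] at h
    obtain ⟨h3, rfl⟩ := h
    have : y = y' := sub_left_injective h3
    subst this
    rfl
  let F : Finset (A × A) := Finset.univ.sigma (fun d => Finset.univ.filter fun x =>
    UsesStep a.fst (a.snd - a.fst) (W d) x) |>.image fun z => (z.1, z.2)
  have hF : F.card ≤ ∑ d, (W d).count (a.snd - a.fst) := by
    refine Finset.card_image_le.trans ?_
    rw [Finset.card_sigma]
    refine Finset.sum_le_sum fun d _ => ?_
    have := ncard_usesStep_le a.fst (a.snd - a.fst) (W d)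
    rwa [Set.ncard_eq_toFinset_card', Set.toFinset_ofPred] at this
  refine le_trans ?_ hF
  rw [← Set.ncard_coe_finset]
  refine Set.ncard_le_ncard_of_injOn (fun p : Request A => (p.1.2 - p.1.1, p.1.1)) ?_
    hinj.injOn (Set.toFinite _)
  intro p hp
  have hp' := hw p.1.1 p.1.2 a (SimpleGraph.Walk.darts_toPath_subset_darts _ hp)
  simp only [F, Finset.coe_image, Set.mem_image]
  exact ⟨⟨p.1.2 - p.1.1, p.1.1⟩, by simpa using hp', rfl⟩

end Translation

/-! ### Balanced words for the residues modulo `n` -/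

section Words

/-- The word of `|a|` letters `g` or `-g` with sum `a • g`. -/
def powerWord {A : Type*} [Neg A] (g : A) (a : ℤ) : List A :=
  List.replicate a.toNat g ++ List.replicate (-a).toNat (-g)

theorem sum_powerWord {A : Type*} [AddCommGroup A] (g : A) (a : ℤ) :
    (powerWord g a).sum = a • g := by
  rw [powerWord, List.sum_append, List.sum_replicate, List.sum_replicate, smul_neg,
    ← natCast_zsmul, ← natCast_zsmul, ← neg_zsmul, ← add_zsmul]
  congr 1
  omega

theorem mem_powerWord {A : Type*} [Neg A] {g h : A} {a : ℤ} (hh : h ∈ powerWord g a) :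
    h = g ∨ h = -g := by
  rw [powerWord, List.mem_append, List.mem_replicate, List.mem_replicate] at hh
  tauto

/-- The quotient of `k` by `s`, rounded to the nearest integer, halves being rounded down. -/
def roundDiv (s k : ℕ) : ℕ := if 2 * (k % s) ≤ s then k / s else k / s + 1

/-- The distance of `k` to the nearest multiple of `s`. -/
def distMul (s k : ℕ) : ℕ := min (k % s) (s - k % s)

theorem natAbs_sub_mul_roundDiv (s k : ℕ) (hs : 0 < s) :
    ((k : ℤ) - s * roundDiv s k).natAbs = distMul s k := by
  have h1 := Nat.div_add_mod k s
  have h2 := Nat.mod_lt k hs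
  rw [roundDiv, distMul]
  split_ifs with h
  · have : (k : ℤ) - s * (k / s : ℕ) = (k % s : ℕ) := by
      have : (s : ℤ) * (k / s : ℕ) + (k % s : ℕ) = k := by exact_mod_cast h1
      linarith
    rw [this]
    omega
  · have : (k : ℤ) - s * (k / s + 1 : ℕ) = (k % s : ℕ) - s := by
      have : (s : ℤ) * (k / s : ℕ) + (k % s : ℕ) = k := by exact_mod_cast h1
      push_cast at this ⊢
      linarith
    rw [this]
    omega

/-- A word in `1, s` and their negatives that represents the residue class of `k` modulo `n`,
chosen to be antisymmetric under negation as far as possible. -/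
def balancedWord (n s k : ℕ) : List (ZMod n) :=
  if k ≤ n / 2 then
    powerWord 1 ((k : ℤ) - s * roundDiv s k) ++ powerWord (s : ZMod n) (roundDiv s k)
  else
    powerWord 1 (-(((n - k : ℕ) : ℤ) - s * roundDiv s (n - k))) ++
      powerWord (s : ZMod n) (-roundDiv s (n - k))

theorem sum_balancedWord (n s k : ℕ) (hk : k ≤ n) : (balancedWord n s k).sum = (k : ZMod n) := by
  rw [balancedWord]
  split_ifs with h
  · rw [List.sum_append, sum_powerWord, sum_powerWord]
    simp only [zsmul_eq_mul]
    push_cast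
    ring
  · rw [List.sum_append, sum_powerWord, sum_powerWord]
    simp only [zsmul_eq_mul]
    push_cast [Nat.cast_sub hk]
    simp only [ZMod.natCast_self]
    ring

/-- The reflection `k ↦ n - k` carries the residues above `n / 2` into `1, …, n / 2`. The inequality
only adds unused values of `g`: at `0`, and at `n / 2` when `n` is even. -/
theorem sum_range_fold_le (n : ℕ) (hn : 0 < n) (f g : ℕ → ℕ) :
    ∑ k ∈ Finset.range n, (if k ≤ n / 2 then f k else g (n - k)) ≤
      ∑ k ∈ Finset.range (n / 2 + 1), (f k + g k) := by
  obtain ⟨M, hM⟩ : ∃ M, n = n / 2 + 1 + M := ⟨n - (n / 2 + 1), by omega⟩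
  have hMN : M ≤ n / 2 := by omega
  generalize hN : n / 2 = N at *
  rw [hM, Finset.sum_range_add, Finset.sum_add_distrib]
  refine Nat.add_le_add (le_of_eq (Finset.sum_congr rfl fun k hk => ?_)) ?_
  · rw [if_pos (Nat.lt_succ_iff.1 (Finset.mem_range.1 hk))]
  · calc ∑ x ∈ Finset.range M, (if N + 1 + x ≤ N then f (N + 1 + x) else g (N + 1 + M - (N + 1 + x)))
        = ∑ x ∈ Finset.range M, g (M - 1 - x + 1) := by
          refine Finset.sum_congr rfl fun x hx => ?_
          have := Finset.mem_range.1 hx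
          rw [if_neg (by omega)]
          congr 1
          omega
      _ = ∑ x ∈ Finset.range M, g (x + 1) := Finset.sum_range_reflect (fun x => g (x + 1)) M
      _ ≤ ∑ x ∈ Finset.range N, g (x + 1) :=
          Finset.sum_le_sum_of_subset (Finset.range_subset_range.2 hMN)
      _ ≤ ∑ x ∈ Finset.range (N + 1), g x := by
          rw [Finset.sum_range_succ']
          omega

theorem sum_zmod_val {M : Type*} [AddCommMonoid M] (n : ℕ) [NeZero n] (f : ℕ → M) :
    ∑ d : ZMod n, f d.val = ∑ k ∈ Finset.range n, f k := by
  refine Finset.sum_nbij ZMod.val ?_ ?_ ?_ ?_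
  · intro d _
    exact Finset.mem_range.2 (ZMod.val_lt d)
  · exact (ZMod.val_injective n).injOn
  · intro k hk
    exact ⟨k, by simp, ZMod.val_cast_of_lt (Finset.mem_range.1 hk)⟩
  · simp

end Words

/-! ### Distinctness of the four generators, and the load of the balanced routing -/

section Distinct

variable {n s : ℕ}

theorem natCast_zmod_ne (a b : ℕ) (hab : a < b) (hb : b < n) : (a : ZMod n) ≠ b := by
  intro h
  have := (ZMod.natCast_eq_natCast_iff' a b n).1 h
  rw [Nat.mod_eq_of_lt (by omega), Nat.mod_eq_of_lt hb] at this
  omega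

theorem natCast_zmod_ne_neg (a b : ℕ) (h0 : 0 < a + b) (hab : a + b < n) :
    (a : ZMod n) ≠ -(b : ZMod n) := by
  intro h
  apply natCast_zmod_ne (n := n) 0 (a + b) h0 hab
  push_cast
  rw [h]
  ring

theorem circulantOne_adj_iff {x y : ZMod n} (hs : 1 < s) (hsn : 2 * s < n) :
    (circulantOne n s).Adj x y ↔ y - x = 1 ∨ y - x = s ∨ y - x = -1 ∨ y - x = -s := by
  have h1 : (0 : ZMod n) ≠ 1 := by
    have := natCast_zmod_ne (n := n) 0 1 (by omega) (by omega)
    simpa using this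
  have h2 : (0 : ZMod n) ≠ s := by
    have := natCast_zmod_ne (n := n) 0 s (by omega) (by omega)
    simpa using this
  rw [circulantOne, SimpleGraph.circulantGraph_adj]
  simp only [Set.mem_insert_iff, Set.mem_singleton_iff]
  constructor
  · rintro ⟨-, h | h⟩
    · rw [← neg_sub x y]
      rcases h with h | h | h | h <;> simp [h]
    · exact h
  · intro h
    refine ⟨?_, Or.inr h⟩
    rintro rfl
    rw [sub_self, eq_comm, eq_comm (b := (s : ZMod n)), zero_eq_neg, zero_eq_neg] at h
    tauto

theorem exists_routing_circulantOne (hs : 1 < s) (hsn : 2 * s < n) :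
    ∃ R : Routing (circulantOne n s), maxArcLoad R ≤
      max (∑ k ∈ Finset.range (n / 2 + 1), distMul s k)
        (∑ k ∈ Finset.range (n / 2 + 1), roundDiv s k) := by
  have : NeZero n := ⟨by omega⟩
  obtain ⟨R, hR⟩ := exists_routing_of_words
    ({1, (s : ZMod n), -1, -(s : ZMod n)} : Set (ZMod n)) (fun d => balancedWord n s d.val)
    (fun d => by simp [sum_balancedWord n s d.val (ZMod.val_lt d).le])
    (fun d g hg => by
      change (circulantOne n s).Adj 0 g
      rw [circulantOne_adj_iff hs hsn, sub_zero]
      rw [balancedWord] at hg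
      split_ifs at hg <;> rw [List.mem_append] at hg <;>
      · rcases hg with hg | hg <;> have := mem_powerWord hg <;> tauto)
  refine ⟨R, ciSup_le' fun a => (hR a).trans ?_⟩
  have hadj := (circulantOne_adj_iff hs hsn).1 a.adj
  generalize a.snd - a.fst = g at hadj
  rw [sum_zmod_val n (fun k => (balancedWord n s k).count g)]
  -- Since `1 < s` and `2 * s < n`, the residues `1, s, -1, -s` are pairwise distinct, so
  -- occurrences of one letter are never confused with those of another.
  have e1 : (1 : ZMod n) ≠ s := by simpa using natCast_zmod_ne (n := n) 1 s hs (by omega)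
  have e2 : (1 : ZMod n) ≠ -1 := by
    simpa using natCast_zmod_ne_neg (n := n) 1 1 (by omega) (by omega)
  have e3 : (1 : ZMod n) ≠ -s := by
    simpa using natCast_zmod_ne_neg (n := n) 1 s (by omega) (by omega)
  have e4 : (s : ZMod n) ≠ -1 := by
    simpa using natCast_zmod_ne_neg (n := n) s 1 (by omega) (by omega)
  have e5 : (s : ZMod n) ≠ -s := natCast_zmod_ne_neg (n := n) s s (by omega) (by omega)
  have hc : ∀ k, (balancedWord n s k).count g =
      if k ≤ n / 2 then (powerWord 1 ((k : ℤ) - s * roundDiv s k) ++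
        powerWord (s : ZMod n) (roundDiv s k)).count g else
      (powerWord 1 (-(((n - k : ℕ) : ℤ) - s * roundDiv s (n - k))) ++
        powerWord (s : ZMod n) (-roundDiv s (n - k))).count g := by
    intro k
    rw [balancedWord]
    split_ifs <;> rfl
  simp only [hc]
  refine (sum_range_fold_le n (by omega) (fun k => (powerWord 1 ((k : ℤ) - s * roundDiv s k) ++
        powerWord (s : ZMod n) (roundDiv s k)).count g) (fun k =>
      (powerWord 1 (-((k : ℤ) - s * roundDiv s k)) ++
        powerWord (s : ZMod n) (-roundDiv s k)).count g)).trans ?_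
  have d1 := fun k => natAbs_sub_mul_roundDiv s k (by omega)
  -- For `±1`, a word and its negation contribute the positive and negative parts of `k - s *
  -- roundDiv s k`, which add up to `distMul s k`. For `±s`, one of them contributes `roundDiv s k`
  -- and the other nothing.
  rcases hadj with rfl | rfl | rfl | rfl
  · refine le_max_of_le_left (Finset.sum_le_sum fun k _ => ?_)
    rw [← d1]
    simp only [powerWord, List.count_append, List.count_replicate, beq_iff_eq]
    simp only [e1.symm, e2.symm, e3.symm, if_true, if_false]
    omega
  · refine le_max_of_le_right (Finset.sum_le_sum fun k _ => ?_)
    simp only [powerWord, List.count_append, List.count_replicate, beq_iff_eq]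
    simp only [e1, e4.symm, e5.symm, if_true, if_false]
    omega
  · refine le_max_of_le_left (Finset.sum_le_sum fun k _ => ?_)
    rw [← d1]
    simp only [powerWord, List.count_append, List.count_replicate, beq_iff_eq, neg_inj]
    simp only [e1.symm, e2, e4, if_true, if_false]
    omega
  · refine le_max_of_le_right (Finset.sum_le_sum fun k _ => ?_)
    simp only [powerWord, List.count_append, List.count_replicate, beq_iff_eq, neg_inj]
    simp only [e1, e3, e5, if_true, if_false]
    omega

end Distinct

/-! ### Exact sums of `distMul` and `roundDiv` over periods -/

section Sums

theorem sum_distMul_period (s : ℕ) :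
    4 * ∑ i ∈ Finset.range s, distMul s i + s % 2 = s ^ 2 := by
  have key : ∀ p : ℕ, ∑ i ∈ Finset.range p, i + ∑ i ∈ Finset.range p, (p - i) = p * p := by
    intro p
    rw [← Finset.sum_add_distrib, Finset.sum_congr rfl (g := fun _ => p)]
    · simp
    · intro i hi
      have := Finset.mem_range.1 hi
      omega
  have hd : ∀ i ∈ Finset.range s, distMul s i = min i (s - i) := by
    intro i hi
    rw [distMul, Nat.mod_eq_of_lt (Finset.mem_range.1 hi)]
  rw [Finset.sum_congr rfl hd]
  obtain ⟨p, hp | hp⟩ := Nat.even_or_odd' s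
  · have : s = p + p := by omega
    subst this
    have h1 : ∑ i ∈ Finset.range p, min i (p + p - i) = ∑ i ∈ Finset.range p, i :=
      Finset.sum_congr rfl fun i hi => by
        have := Finset.mem_range.1 hi
        omega
    have h2 : ∑ i ∈ Finset.range p, min (p + i) (p + p - (p + i)) =
        ∑ i ∈ Finset.range p, (p - i) :=
      Finset.sum_congr rfl fun i hi => by omega
    rw [Finset.sum_range_add, h1, h2, key, show (p + p) % 2 = 0 by omega]
    ring
  · have : s = p + 1 + p := by omega
    subst this
    have h1 : ∑ i ∈ Finset.range (p + 1), min i (p + 1 + p - i) = ∑ i ∈ Finset.range (p + 1), i :=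
      Finset.sum_congr rfl fun i hi => by
        have := Finset.mem_range.1 hi
        omega
    have h2 : ∑ i ∈ Finset.range p, min (p + 1 + i) (p + 1 + p - (p + 1 + i)) =
        ∑ i ∈ Finset.range p, (p - i) :=
      Finset.sum_congr rfl fun i hi => by omega
    rw [Finset.sum_range_add, h1, h2, Finset.sum_range_succ, show (p + 1 + p) % 2 = 1 by omega]
    have := key p
    nlinarith

/-- Sum over `m` full periods and a partial one. -/
theorem sum_range_mul_add (s m t : ℕ) (f : ℕ → ℕ) :
    ∑ k ∈ Finset.range (m * s + t), f k =
      ∑ j ∈ Finset.range m, ∑ i ∈ Finset.range s, f (j * s + i) +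
        ∑ i ∈ Finset.range t, f (m * s + i) := by
  rw [Finset.sum_range_add]
  congr 1
  induction m with
  | zero => simp
  | succ m ih => rw [Nat.succ_mul, Finset.sum_range_add, ih, Finset.sum_range_succ]

theorem sum_distMul (s m t : ℕ) (ht : t ≤ s) :
    4 * ∑ k ∈ Finset.range (m * s + t), distMul s k + m * (s % 2) =
      m * s ^ 2 + 4 * ∑ i ∈ Finset.range t, min i (s - i) := by
  have h : ∀ j i, distMul s (j * s + i) = distMul s i := by
    intro j i
    rw [distMul, distMul, Nat.mul_add_mod_self_right]
  simp only [sum_range_mul_add, h]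
  have h2 : ∑ i ∈ Finset.range t, distMul s i = ∑ i ∈ Finset.range t, min i (s - i) := by
    refine Finset.sum_congr rfl fun i hi => ?_
    rw [distMul, Nat.mod_eq_of_lt ((Finset.mem_range.1 hi).trans_le ht)]
  rw [h2, Finset.sum_const, Finset.card_range, smul_eq_mul, ← sum_distMul_period]
  ring

theorem sum_roundDiv (s m t : ℕ) (ht : t ≤ s) :
    2 * ∑ k ∈ Finset.range (m * s + t), roundDiv s k + m * s  =
      m * m * s + 2 * m * ((s - 1) / 2) + 2 * (m * t + (t - 1 - s / 2)) := by
  -- Counts the remainders `i < t` that are rounded up; the truncated subtraction returns `0` when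
  -- none has passed `s / 2`.
  have hcount : ∀ t, ∑ i ∈ Finset.range t, (if 2 * i ≤ s then 0 else 1) = t - 1 - s / 2 := by
    intro t
    induction t with
    | zero => simp
    | succ t ih =>
      rw [Finset.sum_range_succ, ih]
      split_ifs <;> omega
  have h : ∀ j, ∀ t ≤ s, ∑ i ∈ Finset.range t, roundDiv s (j * s + i) =
      j * t + (t - 1 - s / 2) := by
    intro j t ht
    rw [← hcount t, Finset.sum_congr rfl (g := fun i => j + if 2 * i ≤ s then 0 else 1),
      Finset.sum_add_distrib]
    · simp [mul_comm]
    · intro i hi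
      have hi := (Finset.mem_range.1 hi).trans_le ht
      have h1 : (j * s + i) % s = i := by
        rw [Nat.mul_add_mod_self_right, Nat.mod_eq_of_lt hi]
      have h2 : (j * s + i) / s = j := by
        rw [mul_comm, Nat.mul_add_div (by omega), Nat.div_eq_of_lt hi, add_zero]
      rw [roundDiv, h1, h2]
      split_ifs <;> omega
  rw [sum_range_mul_add, h m t ht, Finset.sum_congr rfl fun j _ => h j s le_rfl]
  have hs : s - 1 - s / 2 = (s - 1) / 2 := by omega
  rw [hs]
  have h3 : 2 * ∑ j ∈ Finset.range m, (j * s + (s - 1) / 2) + m * s =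
      m * m * s + 2 * m * ((s - 1) / 2) := by
    rw [Finset.sum_add_distrib, ← Finset.sum_mul]
    have h4 : 2 * ∑ j ∈ Finset.range m, j + m = m * m := by
      rw [mul_comm 2, Finset.sum_range_id_mul_two]
      cases m with
      | zero => rfl
      | succ m => simp; ring
    rw [← h4]
    simp
    ring
  linarith

end Sums

/-! ### Upper bounds for the arc-forwarding index -/

section Bounds

theorem two_mul_sum_min_le (s t : ℕ) :
    2 * ∑ i ∈ Finset.range (t + 1), min i (s - i) ≤ t * (t + 1) := by
  have h : ∑ i ∈ Finset.range (t + 1), min i (s - i) ≤ ∑ i ∈ Finset.range (t + 1), i :=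
    Finset.sum_le_sum fun i _ => min_le_left _ _
  have h2 := Finset.sum_range_id_mul_two (t + 1)
  rw [Nat.add_sub_cancel] at h2
  linarith

/-- The summand climbs to `s / 2` and then falls; the `u` terms past the peak are each bounded by `s
/ 2`. -/
theorem two_mul_sum_min_le' (s u : ℕ) :
    2 * ∑ i ∈ Finset.range (s / 2 + u + 1), min i (s - i) ≤
      s / 2 * (s / 2 + 1) + 2 * (u * (s / 2)) := by
  rw [show s / 2 + u + 1 = s / 2 + 1 + u by ring, Finset.sum_range_add, mul_add]
  refine Nat.add_le_add (two_mul_sum_min_le s _) (Nat.mul_le_mul_left _ ?_)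
  calc ∑ x ∈ Finset.range u, min (s / 2 + 1 + x) (s - (s / 2 + 1 + x))
      ≤ ∑ _x ∈ Finset.range u, s / 2 := Finset.sum_le_sum fun x _ => by omega
    _ = u * (s / 2) := by simp

theorem sum_distMul_half_le {n s q r : ℕ} (hs : 1 < s) (hn : n = q * s + r) (hr : r < s) :
    8 * ∑ k ∈ Finset.range (n / 2 + 1), distMul s k + q * (s % 2) ≤
      q * s ^ 2 + 2 * s * (r + 1) := by
  -- The range up to `n / 2` consists of `q / 2` full periods plus a remainder, which for odd `q`
  -- reaches past the middle of a period.
  obtain ⟨p, hp | hp⟩ := Nat.even_or_odd' q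
  · have hN : n / 2 + 1 = p * s + (r / 2 + 1) := by
      rw [hn, hp, mul_assoc]
      omega
    have h1 := sum_distMul s p (r / 2 + 1) (by omega)
    have h2 := two_mul_sum_min_le s (r / 2)
    have h3 : r / 2 * (r / 2 + 1) ≤ r / 2 * s := Nat.mul_le_mul_left _ (by omega)
    have h4 : 2 * (r / 2 * s) ≤ r * s := by
      rw [← mul_assoc]
      exact Nat.mul_le_mul_right _ (by omega)
    rw [hN, hp]
    nlinarith
  · obtain ⟨u, hu⟩ : ∃ u, (s + r) / 2 = s / 2 + u := ⟨(s + r) / 2 - s / 2, by omega⟩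
    have hN : n / 2 + 1 = p * s + (s / 2 + u + 1) := by
      rw [← hu, hn, hp, add_mul, mul_assoc]
      omega
    have h1 := sum_distMul s p (s / 2 + u + 1) (by omega)
    have h2 := two_mul_sum_min_le' s u
    have key : 4 * (s / 2 * (s / 2 + 1)) + 8 * (u * (s / 2)) + s % 2 ≤
        s ^ 2 + 2 * s * (r + 1) := by
      obtain ⟨σ, hσ | hσ⟩ := Nat.even_or_odd' s
      · have e : s / 2 = σ := by omega
        have e2 : s % 2 = 0 := by omega
        have e3 : 2 * u ≤ r := by omega
        rw [e, e2, hσ]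
        have := Nat.mul_le_mul_right σ e3
        nlinarith
      · have e : s / 2 = σ := by omega
        have e2 : s % 2 = 1 := by omega
        have e3 : 2 * u ≤ r + 1 := by omega
        rw [e, e2, hσ]
        have := Nat.mul_le_mul_right σ e3
        nlinarith
    rw [hN, hp]
    nlinarith

theorem sum_roundDiv_half_le {n s q r : ℕ} (hs : 1 < s) (hn : n = q * s + r) (hr : r < s) :
    8 * ∑ k ∈ Finset.range (n / 2 + 1), roundDiv s k ≤ q ^ 2 * s + 2 * q * (r + 1) + s := by
  have hh : 2 * ((s - 1) / 2) + 1 ≤ s := by omega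
  obtain ⟨p, hp | hp⟩ := Nat.even_or_odd' q
  · have hN : n / 2 + 1 = p * s + (r / 2 + 1) := by
      rw [hn, hp, mul_assoc]
      omega
    have h1 := sum_roundDiv s p (r / 2 + 1) (by omega)
    rw [show r / 2 + 1 - 1 - s / 2 = 0 by omega] at h1
    have h2 : 2 * (r / 2) ≤ r := by omega
    have h3 := Nat.mul_le_mul_left p h2
    have h4 := Nat.mul_le_mul_left p hh
    rw [hN, hp]
    nlinarith
  · have hN : n / 2 + 1 = p * s + ((s + r) / 2 + 1) := by
      rw [hn, hp, add_mul, mul_assoc]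
      omega
    have h1 := sum_roundDiv s p ((s + r) / 2 + 1) (by omega)
    have h2 : 2 * ((s + r) / 2) ≤ s + r := by omega
    have h3 := Nat.mul_le_mul_left p h2
    have h4 := Nat.mul_le_mul_left p hh
    have h5 : 2 * ((s + r) / 2 + 1 - 1 - s / 2) ≤ r + 1 := by omega
    rw [hN, hp]
    nlinarith

theorem sum_distMul_half_sq_le {s : ℕ} (hs : 1 < s) :
    8 * ∑ k ∈ Finset.range (s * s / 2 + 1), distMul s k + s * (s % 2) ≤ s * s ^ 2 := by
  obtain ⟨p, hp | hp⟩ := Nat.even_or_odd' s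
  · have hN : s * s / 2 + 1 = p * s + (0 + 1) := by
      rw [show s * s = 2 * (p * s) by nlinarith]
      omega
    have h1 := sum_distMul s p (0 + 1) (by omega)
    have h2 := two_mul_sum_min_le s 0
    rw [hN, show s % 2 = 0 by omega] at *
    nlinarith
  · have hN : s * s / 2 + 1 = p * s + (p + 1) := by
      rw [show s * s = 2 * (p * s + p) + 1 by nlinarith]
      omega
    have h1 := sum_distMul s p (p + 1) (by omega)
    have h2 := two_mul_sum_min_le s p
    rw [hN, show s % 2 = 1 by omega] at *
    have : s * s ^ 2 = 2 * p * s ^ 2 + (2 * p + 1) ^ 2 := by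
      subst hp
      ring
    nlinarith

/-- There is no slack here: for `s = 2 * p` the sum is `p ^ 2 * s / 2`, and rounding halves up would
break the bound. -/
theorem sum_roundDiv_half_sq_le {s : ℕ} (hs : 1 < s) :
    8 * ∑ k ∈ Finset.range (s * s / 2 + 1), roundDiv s k + s * (s % 2) ≤ s * s ^ 2 := by
  obtain ⟨p, hp | hp⟩ := Nat.even_or_odd' s
  · have hN : s * s / 2 + 1 = p * s + 1 := by
      rw [show s * s = 2 * (p * s) by nlinarith]
      omega
    have h1 := sum_roundDiv s p 1 (by omega)
    have hh : 2 * ((s - 1) / 2) + 2 = s := by omega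
    rw [hN, show s % 2 = 0 by omega] at *
    rw [show 1 - 1 - s / 2 = 0 by omega] at h1
    have h4 : p * (2 * ((s - 1) / 2) + 2) = p * s := by rw [hh]
    have : s * s ^ 2 = 4 * (p * p * s) := by
      subst hp
      ring
    nlinarith
  · have hN : s * s / 2 + 1 = p * s + (p + 1) := by
      rw [show s * s = 2 * (p * s + p) + 1 by nlinarith]
      omega
    have h1 := sum_roundDiv s p (p + 1) (by omega)
    rw [hN, show s % 2 = 1 by omega] at *
    rw [show (s - 1) / 2 = p by omega, show p + 1 - 1 - s / 2 = 0 by omega] at h1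
    have : s * s ^ 2 = (2 * p + 1) * (2 * p + 1) * s := by
      subst hp
      ring
    nlinarith

theorem arcForwardingIndex_le {n s : ℕ} (hs : 1 < s) (hsn : 2 * s < n) {B : ℕ}
    (h1 : ∑ k ∈ Finset.range (n / 2 + 1), distMul s k ≤ B)
    (h2 : ∑ k ∈ Finset.range (n / 2 + 1), roundDiv s k ≤ B) :
    arcForwardingIndex (circulantOne n s) ≤ B := by
  obtain ⟨R, hR⟩ := exists_routing_circulantOne hs hsn
  exact (ciInf_le' _ R).trans (hR.trans (max_le h1 h2))

theorem arcForwardingIndex_le_of_le {n s q r : ℕ} (hs : 1 < s) (hsn : 2 * s < n)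
    (hn : n = q * s + r) (hr : r < s) (hsq : s ≤ q) :
    8 * arcForwardingIndex (circulantOne n s) ≤ q ^ 2 * s + 2 * q * (r + 1) + s := by
  have h1 := sum_distMul_half_le hs hn hr
  have h2 := sum_roundDiv_half_le hs hn hr
  have h3 : q * s ^ 2 + 2 * s * (r + 1) ≤ q ^ 2 * s + 2 * q * (r + 1) := by
    have e1 : q * s * s ≤ q * s * q := Nat.mul_le_mul_left _ hsq
    have e2 : s * (r + 1) ≤ q * (r + 1) := Nat.mul_le_mul_right _ hsq
    nlinarith
  -- The sums are integers, so both stay below the floor of the rational bound.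
  have := arcForwardingIndex_le hs hsn (B := (q ^ 2 * s + 2 * q * (r + 1) + s) / 8)
    (by omega) (by omega)
  omega

theorem arcForwardingIndex_le_of_ge {n s q r : ℕ} (hs : 1 < s) (hsn : 2 * s < n)
    (hn : n = q * s + r) (hr : r < s) (hsq : q + 2 ≤ s) (hq : 2 ≤ q) :
    8 * arcForwardingIndex (circulantOne n s) + q * (s % 2) ≤ q * s ^ 2 + 2 * s * (r + 1) := by
  have h1 := sum_distMul_half_le hs hn hr
  have h2 := sum_roundDiv_half_le hs hn hr
  have h3 : q ^ 2 * s + 2 * q * (r + 1) + s + q * (s % 2) ≤ q * s ^ 2 + 2 * s * (r + 1) := by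
    -- The gap of 2 between `q` and `s` yields a surplus `2 * q * s`, which absorbs both `s` and the
    -- parity term.
    have e1 : q * s * (q + 2) ≤ q * s * s := Nat.mul_le_mul_left _ hsq
    have e2 : q * (r + 1) ≤ s * (r + 1) := Nat.mul_le_mul_right _ (by omega)
    have e3 : q * (s % 2) ≤ q * s := Nat.mul_le_mul_left _ (by omega)
    have e4 : 2 * s ≤ q * s := Nat.mul_le_mul_right _ hq
    nlinarith
  have := arcForwardingIndex_le hs hsn (B := (q * s ^ 2 + 2 * s * (r + 1) - q * (s % 2)) / 8)
    (by omega) (by omega)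
  omega

theorem arcForwardingIndex_le_of_sq {s : ℕ} (hs : 1 < s) (hsn : 2 * s < s * s) :
    8 * arcForwardingIndex (circulantOne (s * s) s) + s * (s % 2) ≤ s * s ^ 2 := by
  have h1 := sum_distMul_half_sq_le hs
  have h2 := sum_roundDiv_half_sq_le hs
  have := arcForwardingIndex_le hs hsn (B := (s * s ^ 2 - s * (s % 2)) / 8)
    (by omega) (by omega)
  omega

end Bounds

/-! ### Lower bounds from cuts and from distance sums -/

section LowerBounds

variable {n s : ℕ}

theorem nonempty_routing_circulantOne (hs : 1 < s) (hsn : 2 * s < n) :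
    Nonempty (Routing (circulantOne n s)) :=
  (exists_routing_circulantOne hs hsn).nonempty

/-- Indexing by `ZMod n × Bool` bounds the number of edges by `2 * n`; only surjectivity onto the
edges is needed. -/
theorem edge_mem_range [NeZero n] (hs : 1 < s) (hsn : 2 * s < n) :
    (circulantOne n s).edgeSet ⊆
      Set.range fun t : ZMod n × Bool => s(t.1, t.1 + if t.2 then (s : ZMod n) else 1) := by
  intro e he
  induction e using Sym2.ind with
  | _ x y =>
    rcases (circulantOne_adj_iff hs hsn).1 he with h | h | h | h
    · exact ⟨(x, false), by simp [← h]⟩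
    · exact ⟨(x, true), by simp [← h]⟩
    · refine ⟨(y, false), ?_⟩
      have : x = y + 1 := by linear_combination -h
      rw [Sym2.eq_swap]
      simp [this]
    · refine ⟨(y, true), ?_⟩
      have : x = y + s := by linear_combination -h
      rw [Sym2.eq_swap]
      simp [this]

theorem exists_eq_add_mul_of_walk (hs : 1 < s) (hsn : 2 * s < n) {x y : ZMod n}
    (w : (circulantOne n s).Walk x y) :
    ∃ a b : ℤ, y - x = a + b * s ∧ a.natAbs + b.natAbs ≤ w.length := by
  induction w with
  | nil => exact ⟨0, 0, by simp⟩
  | @cons x z y h w ih =>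
    obtain ⟨a, b, hab, hl⟩ := ih
    rw [SimpleGraph.Walk.length_cons]
    rcases (circulantOne_adj_iff hs hsn).1 h with h | h | h | h
    · exact ⟨a + 1, b, by push_cast; linear_combination hab + h, by omega⟩
    · exact ⟨a, b + 1, by push_cast; linear_combination hab + h, by omega⟩
    · exact ⟨a - 1, b, by push_cast; linear_combination hab + h, by omega⟩
    · exact ⟨a, b - 1, by push_cast; linear_combination hab + h, by omega⟩

/-- Double counting: by translation the paths have total length at least `n * ∑ d, D d`, while at
most `2 * n` edges each carry at most the maximum load. Any lower bound `D` for the distance to `0`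
will do. -/
theorem sum_le_two_mul_edgeForwardingIndex [NeZero n] (hs : 1 < s) (hsn : 2 * s < n)
    (D : ZMod n → ℕ) (hD : ∀ a b : ℤ, D (a + b * s) ≤ a.natAbs + b.natAbs) :
    ∑ d, D d ≤ 2 * edgeForwardingIndex (circulantOne n s) := by
  classical
  have := nonempty_routing_circulantOne hs hsn
  obtain ⟨R, hR⟩ := exists_maxEdgeLoad_eq (G := circulantOne n s)
  have h1 := sum_length_le_card_mul_maxEdgeLoad R _ (edge_mem_range hs hsn)
  have h0 : D 0 = 0 := by simpa using hD 0 0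
  have h2 : n * ∑ d, D d ≤ ∑ p : Request (ZMod n),
      (R p : (circulantOne n s).Walk p.1.1 p.1.2).length := by
    have hx : ∀ x : ZMod n, ∑ y, D (y - x) = ∑ d, D d := fun x => (Equiv.subRight x).sum_comp D
    have hdiag : ∑ z : {z : ZMod n × ZMod n // ¬ z.1 ≠ z.2}, D (z.1.2 - z.1.1) = 0 := by
      refine Finset.sum_eq_zero fun z _ => ?_
      have : z.1.1 = z.1.2 := not_not.1 z.2
      rw [this, sub_self, h0]
    have hsub := Fintype.sum_subtype_add_sum_subtype (fun z : ZMod n × ZMod n => z.1 ≠ z.2)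
      (fun z => D (z.2 - z.1))
    rw [hdiag, add_zero, Fintype.sum_prod_type] at hsub
    simp only [hx, Finset.sum_const, Finset.card_univ, ZMod.card, smul_eq_mul] at hsub
    calc n * ∑ d, D d = ∑ p : Request (ZMod n), D (p.1.2 - p.1.1) := hsub.symm
      _ ≤ ∑ p : Request (ZMod n), (R p : (circulantOne n s).Walk p.1.1 p.1.2).length := by
          refine Finset.sum_le_sum fun p _ => ?_
          obtain ⟨a, b, hab, hl⟩ := exists_eq_add_mul_of_walk hs hsn
            (R p : (circulantOne n s).Walk p.1.1 p.1.2)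
          rw [hab]
          exact (hD a b).trans hl
  have h3 : n * ∑ d, D d ≤ n * (2 * maxEdgeLoad R) := by
    refine h2.trans ?_
    rw [Fintype.card_prod, ZMod.card, Fintype.card_bool] at h1
    linarith
  rw [← hR]
  exact Nat.le_of_mul_le_mul_left h3 (NeZero.pos n)

/-- Cut the cycle into arcs of `n / 2` and `n - n / 2` consecutive vertices: a jump of length `g`
crosses each of the two borders from at most `g` starting points, and four times the product of the
two sizes is `n ^ 2 - n % 2`. -/
theorem sq_sub_parity_le_edgeForwardingIndex (hs : 1 < s) (hsn : 2 * s < n) :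
    n ^ 2 ≤ 4 * (s + 1) * edgeForwardingIndex (circulantOne n s) + n % 2 := by
  classical
  have : NeZero n := ⟨by omega⟩
  have := nonempty_routing_circulantOne hs hsn
  obtain ⟨R, hR⟩ := exists_maxEdgeLoad_eq (G := circulantOne n s)
  let S : Finset (ZMod n) := Finset.univ.filter fun x => x.val < n / 2
  have hS : S.card = n / 2 := by
    rw [Finset.card_filter, sum_zmod_val n (fun k => if k < n / 2 then 1 else 0),
      ← Finset.card_filter]
    rw [show (Finset.range n).filter (fun k => k < n / 2) = Finset.range (n / 2) by
      ext k
      simp only [Finset.mem_filter, Finset.mem_range]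
      omega]
    simp
  let T : ℕ → Finset (ℕ × ℕ) := fun g =>
    (Finset.Ico (n / 2 - g) (n / 2) ∪ Finset.Ico (n - g) n) ×ˢ {g}
  have hT : ∀ g, (T g).card ≤ 2 * g := by
    intro g
    rw [Finset.card_product, Finset.card_singleton, mul_one]
    refine (Finset.card_union_le _ _).trans ?_
    rw [Nat.card_Ico, Nat.card_Ico]
    omega
  let f : ℕ × ℕ → Sym2 (ZMod n) := fun t => s((t.1 : ZMod n), t.1 + t.2)
  have hval : ∀ (g : ℕ) (x : ZMod n), g ≤ n / 2 → x.val + g < n →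
      (x + (g : ZMod n)).val = x.val + g := by
    intro g x hg hx
    have hgv : (g : ZMod n).val = g := ZMod.val_cast_of_lt (by omega)
    rw [ZMod.val_add_of_lt (by rwa [hgv]), hgv]
  have hup : ∀ (g : ℕ) (x y : ZMod n), g ≤ n / 2 → x ∈ S → y ∉ S → y - x = g →
      ∃ t ∈ T g, f t = s(x, y) := by
    intro g x y hg hx hy h
    have hy' : y = x + g := by linear_combination h
    simp only [S, Finset.mem_filter, Finset.mem_univ, true_and] at hx hy
    refine ⟨(x.val, g), ?_, by simp [f, hy']⟩
    rw [hy', hval g x hg (by omega)] at hy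
    refine Finset.mem_product.2 ⟨?_, Finset.mem_singleton_self _⟩
    simp only [Finset.mem_union, Finset.mem_Ico]
    omega
  have hdown : ∀ (g : ℕ) (x y : ZMod n), g ≤ n / 2 → x ∈ S → y ∉ S → y - x = -g →
      ∃ t ∈ T g, f t = s(x, y) := by
    intro g x y hg hx hy h
    have hx' : x = y + g := by linear_combination -h
    simp only [S, Finset.mem_filter, Finset.mem_univ, true_and] at hx hy
    refine ⟨(y.val, g), ?_, by rw [Sym2.eq_swap]; simp [f, hx']⟩
    have hyn := ZMod.val_lt y
    -- A vertex outside `S` can enter it by a forward jump only by wrapping around past `n`.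
    have : n ≤ y.val + g := by
      by_contra hlt
      rw [hx', hval g y hg (by omega)] at hx
      omega
    refine Finset.mem_product.2 ⟨?_, Finset.mem_singleton_self _⟩
    simp only [Finset.mem_union, Finset.mem_Ico]
    omega
  have hcut := two_mul_card_mul_card_compl_le R S (T 1 ∪ T s) f (by
    intro x y hxy hx hy
    rcases (circulantOne_adj_iff hs hsn).1 hxy with h | h | h | h
    · obtain ⟨t, ht, hf⟩ := hup 1 x y (by omega) hx hy (by simpa using h)
      exact ⟨t, Finset.mem_union_left _ ht, hf⟩
    · obtain ⟨t, ht, hf⟩ := hup s x y (by omega) hx hy h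
      exact ⟨t, Finset.mem_union_right _ ht, hf⟩
    · obtain ⟨t, ht, hf⟩ := hdown 1 x y (by omega) hx hy (by simpa using h)
      exact ⟨t, Finset.mem_union_left _ ht, hf⟩
    · obtain ⟨t, ht, hf⟩ := hdown s x y (by omega) hx hy h
      exact ⟨t, Finset.mem_union_right _ ht, hf⟩)
  have hcard : (T 1 ∪ T s).card ≤ 2 * (s + 1) :=
    (Finset.card_union_le _ _).trans (by linarith [hT 1, hT s])
  rw [Finset.card_compl, ZMod.card, hS, hR] at hcut
  have h1 := hcut.trans (Nat.mul_le_mul_right _ hcard)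
  obtain ⟨p, hp | hp⟩ := Nat.even_or_odd' n
  · rw [show n - n / 2 = p by omega, show n / 2 = p by omega] at h1
    have : n ^ 2 = 4 * (p * p) := by
      rw [hp]
      ring
    rw [show n % 2 = 0 by omega]
    linarith
  · rw [show n - n / 2 = p + 1 by omega, show n / 2 = p by omega] at h1
    have : n ^ 2 = 4 * (p * (p + 1)) + 1 := by
      rw [hp]
      ring
    rw [show n % 2 = 1 by omega]
    linarith

/-- Sum over a symmetric integer interval of a function of the absolute value. -/
theorem sum_Icc_natAbs (f : ℕ → ℕ) (K : ℕ) :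
    ∑ a ∈ Finset.Icc (-(K : ℤ)) K, f a.natAbs = f 0 + 2 * ∑ i ∈ Finset.range K, f (i + 1) := by
  induction K with
  | zero => simp
  | succ K ih =>
    have : Finset.Icc (-((K + 1 : ℕ) : ℤ)) (K + 1 : ℕ) =
        insert (-((K + 1 : ℕ) : ℤ)) (insert ((K + 1 : ℕ) : ℤ) (Finset.Icc (-(K : ℤ)) K)) := by
      ext a
      simp only [Finset.mem_Icc, Finset.mem_insert]
      omega
    rw [this, Finset.sum_insert, Finset.sum_insert, ih, Finset.sum_range_succ]
    · rw [Int.natAbs_neg, Int.natAbs_natCast]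
      ring
    · simp
    · simp only [Finset.mem_insert, Finset.mem_Icc, not_or]
      omega

theorem sum_Icc_sub_natAbs (j K : ℕ) (hj : j ≤ K) :
    ∑ b ∈ Finset.Icc (-(K : ℤ)) K, (j - b.natAbs) = j ^ 2 := by
  rw [sum_Icc_natAbs (fun i => j - i)]
  obtain ⟨u, rfl⟩ := Nat.exists_eq_add_of_le hj
  rw [Finset.sum_range_add]
  have h1 : ∑ x ∈ Finset.range u, (j - (j + x + 1)) = 0 :=
    Finset.sum_eq_zero fun x _ => by omega
  have h2 : ∀ j : ℕ, j + 2 * ∑ i ∈ Finset.range j, (j - (i + 1)) = j ^ 2 := by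
    intro j
    have h3 : ∑ i ∈ Finset.range j, (j - (i + 1)) = ∑ i ∈ Finset.range j, i := by
      rw [← Finset.sum_range_reflect (fun i => i) j]
      exact Finset.sum_congr rfl fun i _ => by omega
    rw [h3, mul_comm 2, Finset.sum_range_id_mul_two]
    cases j with
    | zero => rfl
    | succ j => simp; ring
  rw [h1, add_zero]
  exact h2 j

theorem three_mul_sum_box (K : ℕ) :
    3 * ∑ z ∈ Finset.Icc (-(K : ℤ)) K ×ˢ Finset.Icc (-(K : ℤ)) K,
      (K - z.1.natAbs - z.2.natAbs) = 2 * K ^ 3 + K := by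
  rw [Finset.sum_product]
  simp only
  rw [Finset.sum_congr rfl fun a _ => sum_Icc_sub_natAbs (K - a.natAbs) K (Nat.sub_le _ _),
    sum_Icc_natAbs (fun i => (K - i) ^ 2)]
  have h : ∑ i ∈ Finset.range K, (K - (i + 1)) ^ 2 = ∑ i ∈ Finset.range K, i ^ 2 := by
    rw [← Finset.sum_range_reflect (fun i => i ^ 2) K]
    exact Finset.sum_congr rfl fun i _ => by congr 1; omega
  rw [h, Nat.sub_zero]
  clear h
  induction K with
  | zero => rfl
  | succ K ih =>
    rw [Finset.sum_range_succ]
    nlinarith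

/-- Summing `K ≤ (K - D d) + D d` over all residues, with truncated subtraction, bounds the distance
sum below by `n * K` minus the total deficit. Shortest representations inject residues into `ℤ²`, so
the deficit is at most that of the full `ℓ¹` ball, `(2 * K ^ 3 + K) / 3`. -/
theorem mul_le_edgeForwardingIndex (hs : 1 < s) (hsn : 2 * s < n) (K : ℕ) :
    3 * n * K ≤ 6 * edgeForwardingIndex (circulantOne n s) + 2 * K ^ 3 + K := by
  classical
  have : NeZero n := ⟨by omega⟩
  let P : ZMod n → ℕ → Prop := fun d k => ∃ a b : ℤ, d = a + b * s ∧ a.natAbs + b.natAbs = k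
  have hP : ∀ d, ∃ k, P d k := fun d => ⟨_, (d.val : ℤ), 0, by simp, rfl⟩
  let D : ZMod n → ℕ := fun d => Nat.find (hP d)
  have hD := sum_le_two_mul_edgeForwardingIndex hs hsn D fun a b =>
    Nat.find_min' (hP _) ⟨a, b, rfl, rfl⟩
  choose a b hab hk using fun d => Nat.find_spec (hP d)
  have hsum : ∑ d, (K - D d) ≤ ∑ z ∈ Finset.Icc (-(K : ℤ)) K ×ˢ Finset.Icc (-(K : ℤ)) K,
      (K - z.1.natAbs - z.2.natAbs) := by
    have hinj : Function.Injective fun d => (a d, b d) := by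
      intro d e h
      simp only [Prod.mk.injEq] at h
      rw [hab d, hab e, h.1, h.2]
    have h1 : ∑ d, (K - D d) = ∑ d ∈ Finset.univ.filter (fun d => D d ≤ K), (K - D d) := by
      rw [Finset.sum_filter]
      exact Finset.sum_congr rfl fun d _ => by split_ifs <;> omega
    have h2 : ∑ d ∈ Finset.univ.filter (fun d => D d ≤ K), (K - D d) =
        ∑ z ∈ (Finset.univ.filter (fun d => D d ≤ K)).image (fun d => (a d, b d)),
          (K - z.1.natAbs - z.2.natAbs) := by
      rw [Finset.sum_image hinj.injOn]
      refine Finset.sum_congr rfl fun d _ => ?_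
      have : (a d).natAbs + (b d).natAbs = D d := hk d
      simp only
      omega
    rw [h1, h2]
    refine Finset.sum_le_sum_of_subset fun z hz => ?_
    obtain ⟨d, hd, rfl⟩ := Finset.mem_image.1 hz
    have h3 : (a d).natAbs + (b d).natAbs = D d := hk d
    have h4 := (Finset.mem_filter.1 hd).2
    simp only [Finset.mem_product, Finset.mem_Icc]
    omega
  have hK : n * K ≤ ∑ d, (K - D d) + ∑ d, D d := by
    rw [← Finset.sum_add_distrib]
    calc n * K = ∑ _d : ZMod n, K := by simp [ZMod.card]
      _ ≤ _ := Finset.sum_le_sum fun d _ => by omega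
  have := three_mul_sum_box K
  nlinarith

/-- The class of `z` modulo `s ^ 2` is `i + j s` with `i = z % s` and `j = z / s`; its distance to
`0` in `C_{s^2}(1, s)`. -/
def squareDist (s : ℕ) (z : ℤ) : ℤ :=
  min (z % s + min (z / s % s) (s - z / s % s))
    (s - z % s + min ((z / s + 1) % s) (s - (z / s + 1) % s))

theorem min_emod_le (s : ℕ) (hs : 0 < s) (x : ℤ) :
    min (x % s) (s - x % s) ≤ x.natAbs := by
  have h1 := Int.mul_ediv_add_emod x s
  have h2 := Int.emod_nonneg x (b := s) (by omega)
  have h3 := Int.emod_lt_of_pos x (b := s) (by omega)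
  rcases le_or_gt 0 x with hx | hx
  · have : 0 ≤ (s : ℤ) * (x / s) :=
      mul_nonneg (by omega) (Int.ediv_nonneg hx (by omega))
    omega
  · have : x / s ≤ -1 := by
      have := Int.ediv_neg_of_neg_of_pos hx (b := s) (by omega)
      omega
    have : (s : ℤ) * (x / s) ≤ s * -1 := mul_le_mul_of_nonneg_left this (by omega)
    omega

/-- Write `a = s * u + i` with `0 ≤ i < s`. If `u ≥ 0`, then `|a| ≥ i + u`, and `u + |b|` pays for
the distance of `u + b` to a multiple of `s`. If `u < 0`, then `|a| ≥ (s - i) + |u + 1|`, and the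
row is `u + b + 1`. -/
theorem squareDist_add_mul_le (s : ℕ) (hs : 0 < s) (a b : ℤ) :
    squareDist s (a + b * s) ≤ a.natAbs + b.natAbs := by
  have hs' : (0 : ℤ) < s := by omega
  have h1 := Int.mul_ediv_add_emod a s
  have h2 := Int.emod_nonneg a (b := s) (by omega)
  have h3 := Int.emod_lt_of_pos a hs'
  have e1 : (a + b * s) % s = a % s := Int.add_mul_emod_self_right ..
  have e2 : (a + b * s) / s = a / s + b := Int.add_mul_ediv_right _ _ (by omega)
  rw [squareDist, e1, e2]
  rcases le_or_gt 0 (a / s) with hu | hu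
  · have h4 := min_emod_le s hs (a / s + b)
    have h5 : 1 * (a / s) ≤ s * (a / s) := mul_le_mul_of_nonneg_right (by omega) hu
    refine (min_le_left _ _).trans ?_
    omega
  · have h4 := min_emod_le s hs (a / s + b + 1)
    have h5 : (s : ℤ) * (a / s + 1) ≤ 1 * (a / s + 1) :=
      mul_le_mul_of_nonpos_right (by omega) (by omega)
    rw [mul_add, mul_one, one_mul] at h5
    refine (min_le_right _ _).trans ?_
    omega

theorem squareDist_add_mul_self (s : ℕ) (hs : 0 < s) (z k : ℤ) :
    squareDist s (z + k * (s * s)) = squareDist s z := by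
  have e1 : (z + k * (s * s)) % s = z % s := by
    rw [← mul_assoc, Int.add_mul_emod_self_right]
  have e2 : (z + k * (s * s)) / s = z / s + k * s := by
    rw [← mul_assoc, Int.add_mul_ediv_right _ _ (by omega)]
  have e3 : (z / s + k * s + 1) % s = (z / s + 1) % s := by
    rw [add_right_comm, Int.add_mul_emod_self_right]
  rw [squareDist, squareDist, e1, e2, Int.add_mul_emod_self_right, e3]

end LowerBounds

/-! ### The distance sum for `n = s ^ 2` -/

section Square

theorem squareDist_nat (s i j : ℕ) (hi : i < s) (hj : j < s) :
    (squareDist s ((j * s + i : ℕ) : ℤ)).toNat =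
      min (i + distMul s j) (s - i + distMul s (j + 1)) := by
  have e1 : ((j * s + i : ℕ) : ℤ) % s = i := by
    rw [← Int.natCast_mod, Nat.mul_add_mod_self_right, Nat.mod_eq_of_lt hi]
  have e2 : ((j * s + i : ℕ) : ℤ) / s = j := by
    rw [← Int.natCast_div, mul_comm, Nat.mul_add_div (by omega), Nat.div_eq_of_lt hi, add_zero]
  have e3 : (j : ℤ) % s = j := by rw [← Int.natCast_mod, Nat.mod_eq_of_lt hj]
  have e4 : ((j : ℤ) + 1) % s = ((j + 1) % s : ℕ) := by push_cast; rfl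
  have h4 : (j + 1) % s < s := Nat.mod_lt _ (by omega)
  rw [squareDist, e1, e2, e3, e4, distMul, distMul, Nat.mod_eq_of_lt hj]
  omega

theorem sum_distMul_succ (s : ℕ) :
    ∑ j ∈ Finset.range s, distMul s (j + 1) = ∑ j ∈ Finset.range s, distMul s j := by
  have h1 := Finset.sum_range_succ' (distMul s) s
  have h2 := Finset.sum_range_succ (distMul s) s
  have h3 : distMul s s = 0 := by simp [distMul]
  have h4 : distMul s 0 = 0 := by simp [distMul]
  omega

/-- Adjacent values of `distMul` differ by at most 1, so off the middle column the nearer side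
attains the minimum. When `2 * i = s` the minimum is within `1 / 2` of the average, hence the
correction term. -/
theorem two_mul_min_distMul_ge (s i j : ℕ) (hi : i < s) (hj : j < s) :
    2 * distMul s i + (if 2 * i < s then 2 * distMul s j else if s < 2 * i then
      2 * distMul s (j + 1) else distMul s j + distMul s (j + 1)) ≤
    2 * min (i + distMul s j) (s - i + distMul s (j + 1)) + if 2 * i = s then 1 else 0 := by
  have e1 : distMul s i = min i (s - i) := by rw [distMul, Nat.mod_eq_of_lt hi]
  have e2 : distMul s j = min j (s - j) := by rw [distMul, Nat.mod_eq_of_lt hj]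
  have e3 : distMul s (j + 1) = min (j + 1) (s - (j + 1)) := by
    rcases Nat.lt_or_ge (j + 1) s with h | h
    · rw [distMul, Nat.mod_eq_of_lt h]
    · obtain rfl : s = j + 1 := by omega
      simp [distMul]
  rw [e1, e2, e3]
  split_ifs <;> omega

theorem cube_le_sum_squareDist (s : ℕ) :
    s * s ^ 2 ≤ 2 * ∑ k ∈ Finset.range (s * s), (squareDist s k).toNat + s := by
  have h1 := sum_range_mul_add s s 0 (fun k => (squareDist s k).toNat)
  rw [add_zero, Finset.sum_range_zero, add_zero, Finset.sum_comm] at h1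
  have h2 : ∀ i ∈ Finset.range s, s * (2 * distMul s i) + 2 * ∑ j ∈ Finset.range s, distMul s j ≤
      2 * ∑ j ∈ Finset.range s, (squareDist s ((j * s + i : ℕ) : ℤ)).toNat +
        s * if 2 * i = s then 1 else 0 := by
    intro i hi
    have hi := Finset.mem_range.1 hi
    have h3 := Finset.sum_le_sum fun j (hj : j ∈ Finset.range s) =>
      two_mul_min_distMul_ge s i j hi (Finset.mem_range.1 hj)
    rw [Finset.sum_add_distrib, Finset.sum_add_distrib, Finset.sum_const,
      Finset.sum_const, Finset.card_range, smul_eq_mul, smul_eq_mul, ← Finset.mul_sum] at h3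
    rw [Finset.sum_congr rfl fun j hj => squareDist_nat s i j hi (Finset.mem_range.1 hj)]
    refine le_trans (Nat.add_le_add_left (le_of_eq ?_) _) h3
    have h4 := sum_distMul_succ s
    split_ifs
    · rw [Finset.mul_sum]
    · rw [← h4, Finset.mul_sum]
    · rw [Finset.sum_add_distrib, h4, two_mul]
  have h3 := Finset.sum_le_sum h2
  rw [Finset.sum_add_distrib, Finset.sum_add_distrib, ← Finset.mul_sum, ← Finset.mul_sum,
    ← Finset.mul_sum, ← Finset.mul_sum, ← Finset.mul_sum, Finset.sum_const, Finset.card_range, smul_eq_mul,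
    ← h1] at h3
  -- The loss of `s` arises once for either parity: from the middle column if `s` is even, from the
  -- odd term of `sum_distMul_period` if `s` is odd.
  have h5 : ∑ i ∈ Finset.range s, (if 2 * i = s then 1 else 0) + s % 2 ≤ 1 := by
    rcases Nat.mod_two_eq_zero_or_one s with h | h
    · have : ∀ i ∈ Finset.range s, (if 2 * i = s then 1 else 0) = if s / 2 = i then 1 else 0 := by
        intro i _
        split_ifs <;> omega
      rw [Finset.sum_congr rfl this, Finset.sum_ite_eq, h]
      split_ifs <;> omega
    · rw [Finset.sum_eq_zero fun i _ => if_neg (by omega), h]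
  have h6 := sum_distMul_period s
  have h7 := Nat.mul_le_mul_left s h5
  have h8 : s * (4 * ∑ i ∈ Finset.range s, distMul s i + s % 2) = s * s ^ 2 := by rw [h6]
  nlinarith

theorem cube_le_edgeForwardingIndex {s : ℕ} (hs : 1 < s) (hsn : 2 * s < s * s) :
    s * s ^ 2 ≤ 4 * edgeForwardingIndex (circulantOne (s * s) s) + s := by
  have : NeZero (s * s) := ⟨by omega⟩
  have h1 := sum_le_two_mul_edgeForwardingIndex hs hsn
    (fun d => (squareDist s d.val).toNat) (fun a b => by
      have h2 := squareDist_add_mul_le s (by omega) a b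
      have h3 : (((a : ZMod (s * s)) + b * s).val : ℤ) =
          a + b * s + (-((a + b * s) / ((s * s : ℕ) : ℤ))) * (s * s) := by
        have h4 := ZMod.val_intCast (n := s * s) (a + b * s)
        push_cast at h4
        rw [h4, Int.emod_def]
        push_cast
        ring
      rw [h3, squareDist_add_mul_self s (by omega)]
      omega)
  rw [sum_zmod_val (s * s) (fun k => (squareDist s k).toNat)] at h1
  have h2 := cube_le_sum_squareDist s
  omega

end Square

/-! ### Passage to real numbers -/

section Real

theorem parity_eq_mod (x : ℕ) : parity x = x % 2 := by
  rw [parity]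
  split_ifs with h
  · exact (Nat.odd_iff.1 h).symm
  · exact (Nat.even_iff.1 (Nat.not_odd_iff_even.1 h)).symm

theorem cube_sqrt_le_edgeForwardingIndex {n s : ℕ} (hs : 1 < s) (hsn : 2 * s < n) :
    ((n : ℝ) - 1) * (√(2 * (n : ℝ)) - 7) ^ 3 / (24 * (n : ℝ)) ≤
      (edgeForwardingIndex (circulantOne n s) : ℝ) / 2 := by
  have hn : (1 : ℝ) ≤ n := by exact_mod_cast (by omega : 1 ≤ n)
  have hE : (0 : ℝ) ≤ edgeForwardingIndex (circulantOne n s) := Nat.cast_nonneg _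
  -- `t = √(n / 2)` maximizes `3 * n * K - 2 * K ^ 3` over real `K ≥ 0`; its floor is the radius
  -- used below.
  set t : ℝ := √(2 * (n : ℝ)) / 2 with ht
  have ht0 : 0 ≤ t := by positivity
  have ht2 : 2 * t ^ 2 = n := by
    rw [ht, div_pow, Real.sq_sqrt (by positivity)]
    ring
  have e : √(2 * (n : ℝ)) = 2 * t := by rw [ht]; ring
  rw [e]
  rcases le_or_gt (2 * t - 7) 0 with h | h
  · have h1 : (2 * t - 7) ^ 3 ≤ 0 := by
      have : (2 * t - 7) ^ 3 = (2 * t - 7) ^ 2 * (2 * t - 7) := by ring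
      rw [this]
      exact mul_nonpos_of_nonneg_of_nonpos (sq_nonneg _) h
    have h2 : ((n : ℝ) - 1) * (2 * t - 7) ^ 3 ≤ 0 :=
      mul_nonpos_of_nonneg_of_nonpos (by linarith) h1
    exact (div_nonpos_of_nonpos_of_nonneg h2 (by positivity)).trans (by positivity)
  · have h1 : ((n : ℝ) - 1) * (2 * t - 7) ^ 3 / (24 * (n : ℝ)) ≤ (2 * t - 7) ^ 3 / 24 := by
      rw [div_le_div_iff₀ (by positivity) (by norm_num)]
      have : 0 ≤ (2 * t - 7) ^ 3 := by positivity
      nlinarith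
    have h2 := mul_le_edgeForwardingIndex hs hsn ⌊t⌋₊
    have h3 : (3 : ℝ) * n * (⌊t⌋₊ : ℝ) ≤ 6 * (edgeForwardingIndex (circulantOne n s) : ℝ) +
        2 * (⌊t⌋₊ : ℝ) ^ 3 + ⌊t⌋₊ := by exact_mod_cast h2
    have h4 : (⌊t⌋₊ : ℝ) ≤ t := Nat.floor_le ht0
    have h5 : t < ⌊t⌋₊ + 1 := Nat.lt_floor_add_one t
    rw [← ht2] at h3
    obtain ⟨δ, hδ⟩ : ∃ δ : ℝ, (⌊t⌋₊ : ℝ) = t - δ := ⟨t - ⌊t⌋₊, by ring⟩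
    rw [hδ] at h3 h4 h5
    have hd0 : 0 ≤ δ := by linarith
    have hd1 : δ ≤ 1 := by linarith
    -- As `t` is a critical point, the `t ^ 2 * δ` terms cancel and rounding costs only a term
    -- linear in `t`, which the constant 7 absorbs.
    have h6 : 4 * t ^ 3 - 6 * t * δ ^ 2 + 2 * δ ^ 3 - t + δ ≤
        6 * (edgeForwardingIndex (circulantOne n s) : ℝ) := by nlinarith
    have h7 : t * δ ^ 2 ≤ t := mul_le_of_le_one_right ht0 (pow_le_one₀ hd0 hd1)
    have h8 : 0 ≤ δ ^ 3 := by positivity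
    refine h1.trans ?_
    have h9 : (2 * t - 7) ^ 3 = 8 * t ^ 3 - 84 * t ^ 2 + 294 * t - 343 := by ring
    nlinarith

end Real

end CirculantForwarding

theorem mainTheorem1 (n s q r : ℕ) (hn : 5 ≤ n) (hs1 : 1 < s) (hs2 : (s : ℝ) < (n : ℝ) / 2)
    (hq : q = n / s) (hr : n = q * s + r) :
    ((2 ≤ s ∧ (s : ℝ) ≤ √(n : ℝ) - 1) →
      ((n : ℝ) ^ 2 - (CirculantForwarding.parity n : ℝ)) / (8 * ((s : ℝ) + 1)) ≤
          (CirculantForwarding.edgeForwardingIndex (CirculantForwarding.circulantOne n s) : ℝ) / 2 ∧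
        (CirculantForwarding.edgeForwardingIndex (CirculantForwarding.circulantOne n s) : ℝ) / 2 ≤
          (CirculantForwarding.arcForwardingIndex (CirculantForwarding.circulantOne n s) : ℝ) ∧
        (CirculantForwarding.arcForwardingIndex (CirculantForwarding.circulantOne n s) : ℝ) ≤
          (((n : ℝ) - r) * ((n : ℝ) + r + 2) + (s : ℝ) ^ 2) / (8 * (s : ℝ))) ∧
    ((s : ℝ) = √(n : ℝ) →
      √(n : ℝ) * ((n : ℝ) - 1) / 8 ≤
          (CirculantForwarding.edgeForwardingIndex (CirculantForwarding.circulantOne n s) : ℝ) / 2 ∧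
        (CirculantForwarding.edgeForwardingIndex (CirculantForwarding.circulantOne n s) : ℝ) / 2 ≤
          (CirculantForwarding.arcForwardingIndex (CirculantForwarding.circulantOne n s) : ℝ) ∧
        (CirculantForwarding.arcForwardingIndex (CirculantForwarding.circulantOne n s) : ℝ) ≤
          √(n : ℝ) * ((n : ℝ) - (CirculantForwarding.parity s : ℝ)) / 8) ∧
    ((√(n : ℝ) + 1 ≤ (s : ℝ) ∧ (s : ℝ) < (n : ℝ) / 2) →
      max (((n : ℝ) ^ 2 - (CirculantForwarding.parity n : ℝ)) / (8 * ((s : ℝ) + 1)))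
            (((n : ℝ) - 1) * (√(2 * (n : ℝ)) - 7) ^ 3 / (24 * (n : ℝ))) ≤
          (CirculantForwarding.edgeForwardingIndex (CirculantForwarding.circulantOne n s) : ℝ) / 2 ∧
        (CirculantForwarding.edgeForwardingIndex (CirculantForwarding.circulantOne n s) : ℝ) / 2 ≤
          (CirculantForwarding.arcForwardingIndex (CirculantForwarding.circulantOne n s) : ℝ) ∧
        (CirculantForwarding.arcForwardingIndex (CirculantForwarding.circulantOne n s) : ℝ) ≤
          ((s : ℝ) ^ 2 * ((n : ℝ) + r + 2)
            - (CirculantForwarding.parity s : ℝ) * ((n : ℝ) - r)) / (8 * (s : ℝ))) := by 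
  have h2sn : 2 * s < n := by
    have : (2 * s : ℝ) < n := by linarith
    exact_mod_cast this
  have hs0 : (0 : ℝ) < s := by exact_mod_cast (by omega : 0 < s)
  have hrs : r < s := by
    have h1 := Nat.div_add_mod n s
    have h2 := Nat.mod_lt n (by omega : s > 0)
    rw [← hq, mul_comm] at h1
    omega
  have hnR : (n : ℝ) = q * s + r := by exact_mod_cast hr
  have hsqrt : √(n : ℝ) ^ 2 = n := Real.sq_sqrt (Nat.cast_nonneg n)
  have hsqrt0 : 0 ≤ √(n : ℝ) := Real.sqrt_nonneg _
  have hmid : (CirculantForwarding.edgeForwardingIndex (CirculantForwarding.circulantOne n s) : ℝ) / 2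
      ≤ (CirculantForwarding.arcForwardingIndex (CirculantForwarding.circulantOne n s) : ℝ) := by
    have : NeZero n := ⟨by omega⟩
    have := CirculantForwarding.nonempty_routing_circulantOne hs1 h2sn
    have h : (CirculantForwarding.edgeForwardingIndex (CirculantForwarding.circulantOne n s) : ℝ) ≤
        2 * (CirculantForwarding.arcForwardingIndex (CirculantForwarding.circulantOne n s) : ℝ) := by
      exact_mod_cast CirculantForwarding.edgeForwardingIndex_le_two_mul_arcForwardingIndex
    linarith
  have hcut : ((n : ℝ) ^ 2 - (CirculantForwarding.parity n : ℝ)) / (8 * ((s : ℝ) + 1)) ≤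
      (CirculantForwarding.edgeForwardingIndex (CirculantForwarding.circulantOne n s) : ℝ) / 2 := by
    have h : (n : ℝ) ^ 2 ≤ 4 * (s + 1) *
        (CirculantForwarding.edgeForwardingIndex (CirculantForwarding.circulantOne n s) : ℝ) +
          (n % 2 : ℕ) := by
      exact_mod_cast CirculantForwarding.sq_sub_parity_le_edgeForwardingIndex hs1 h2sn
    rw [CirculantForwarding.parity_eq_mod, div_le_iff₀ (by positivity)]
    linarith
  refine ⟨fun ⟨_, h⟩ => ⟨hcut, hmid, ?_⟩, fun h => ?_, fun ⟨h, _⟩ => ⟨max_le hcut ?_, hmid, ?_⟩⟩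
  -- Case (a): `(s + 1) ^ 2 ≤ n` forces `s ≤ q`, so the `±s` bound governs.
  · have hsn : (s + 1) * (s + 1) ≤ n := by
      have : ((s : ℝ) + 1) * (s + 1) ≤ n := by nlinarith
      exact_mod_cast this
    have hsq : s ≤ q := by
      rw [hq, Nat.le_div_iff_mul_le (by omega)]
      nlinarith
    have hu : 8 * (CirculantForwarding.arcForwardingIndex (CirculantForwarding.circulantOne n s) : ℝ)
        ≤ q ^ 2 * s + 2 * q * (r + 1) + s := by
      exact_mod_cast CirculantForwarding.arcForwardingIndex_le_of_le hs1 h2sn hr hrs hsq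
    rw [le_div_iff₀ (by positivity)]
    have := mul_le_mul_of_nonneg_right hu hs0.le
    rw [hnR]
    linarith
  · have hns : n = s * s := by
      have : (n : ℝ) = s * s := by rw [← hsqrt, h]; ring
      exact_mod_cast this
    have hsq : (n : ℝ) = s ^ 2 := by rw [← hsqrt, h]
    rw [← h]
    refine ⟨?_, hmid, ?_⟩
    · have hl : (s : ℝ) * s ^ 2 ≤ 4 *
          (CirculantForwarding.edgeForwardingIndex (CirculantForwarding.circulantOne n s) : ℝ) +
            s := by
        have := CirculantForwarding.cube_le_edgeForwardingIndex hs1 (hns ▸ h2sn)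
        rw [← hns] at this
        exact_mod_cast this
      rw [hsq]
      linarith
    · have hu : 8 *
          (CirculantForwarding.arcForwardingIndex (CirculantForwarding.circulantOne n s) : ℝ) +
            s * (s % 2 : ℕ) ≤ s * s ^ 2 := by
        have := CirculantForwarding.arcForwardingIndex_le_of_sq hs1 (hns ▸ h2sn)
        rw [← hns] at this
        exact_mod_cast this
      rw [CirculantForwarding.parity_eq_mod, hsq]
      linarith
  · exact CirculantForwarding.cube_sqrt_le_edgeForwardingIndex hs1 h2sn
  -- Case (c): this is `n ≤ (s - 1) ^ 2`, which rules out `q ≥ s - 1`, so the `±1` bound governs.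
  · have hsn : n + 2 * s ≤ s * s + 1 := by
      have : (n : ℝ) + 2 * s ≤ s * s + 1 := by nlinarith
      exact_mod_cast this
    have hq2 : 2 ≤ q := by
      rw [hq, Nat.le_div_iff_mul_le (by omega)]
      omega
    have hsq : q + 2 ≤ s := by
      by_contra hlt
      have : s * s ≤ s * (q + 1) := Nat.mul_le_mul_left _ (by omega)
      nlinarith
    have hu : 8 * (CirculantForwarding.arcForwardingIndex (CirculantForwarding.circulantOne n s) : ℝ)
        + q * (s % 2 : ℕ) ≤ q * s ^ 2 + 2 * s * (r + 1) := by
      exact_mod_cast CirculantForwarding.arcForwardingIndex_le_of_ge hs1 h2sn hr hrs hsq hq2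
    rw [CirculantForwarding.parity_eq_mod, le_div_iff₀ (by positivity)]
    have := mul_le_mul_of_nonneg_right hu hs0.le
    rw [hnR]
    linarith
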